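/- Let $\mathcal X$ be a finite alphabet with $a=|\mathcal X|$ and $\mathcal H$ a complex Hilbert space of finite dimension $d$. A cq-channel is a map $W$ assigning to each $x\in\mathcal X$ a state (density operator) $W_x$ on $\mathcal H$; put $W_{x^n}=W_{x_1}\otimes\cdots\otimes W_{x_n}$ for $x^n=x_1\ldots x_n\in\mathcal X^n$. For a probability distribution $P$ on $\mathcal X$ let $I(P;W)=H\big(\sum_x P(x)W_x\big)-\sum_x P(x)H(W_x)$, where $H$ is the von Neumann entropy with logarithms to base $2$. An $n$-block code is a pair $(f,D)$ of a map $f:\mathcal M\to\mathcal X^n$ on a finite set $\mathcal M$ and a family $D=(D_m)_{m\in\mathcal M'}$ of positive semidefinite operators on $\mathcal H^{\otimes n}$ with $\sum_{m\in\mathcal M'}D_m=\mathbb 1$, indexed by a finite set $\mathcal M'\supseteq\mathcal M$. It is an $(n,\lambda)$-code for $W$ if $1-\operatorname{Tr}(W_{f(m)}D_m)\le\lambda$ for all $m\in\mathcal M$. Fix diagonalizations $W_x=\sum_{j} W(j|x)\,\pi_{xj}$, where $j$ runs over a $d$-element set and, for each $x$, the $\pi_{xj}$ are the projectors onto the vectors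 of an orthonormal basis of $\mathcal H$. For $x^n\in\mathcal X^n$ put $I_x=\{i: x_i=x\}$ and, for $\delta>0$, $$\Pi^n_{W,\delta}(x^n)=\bigotimes_{x\in\mathcal X}\ \sum_{j^{I_x}\in T_x}\ \bigotimes_{i\in I_x}\pi_{x j_i},$$ where $T_x$ is the set of families $j^{I_x}=(j_i)_{i\in I_x}$ such that, for every $j$, $$\big||\{i\in I_x: j_i=j\}|-|I_x|\,W(j|x)\big|\le\delta\sqrt{|I_x|}\sqrt{W(j|x)(1-W(j|x))}.$$ **Theorem (Code construction).** For all $\lambda,\tau\in(0,1)$ and all $a,d$ there exist $\delta>0$ and a constant $K$, both depending only on $\lambda,\tau,a,d$, such that for every $\mathcal X$ with $|\mathcal X|=a$, every $\mathcal H$ with $\dim\mathcal H=d$, every cq-channel $W$ (with any choice of diagonalizations as above), every probability distribution $P$ on $\mathcal X$, every $n>0$ and every $A\subseteq\mathcal X^n$ with $P^{\otimes n}(A)\ge\tau$, there is an $(n,\lambda)$-code $(f,D)$ for $W$ such that $$\forall m\in\mathcal M:\quad f(m)\in A\quad\text{and}\quad \operatorname{Tr}D_m\le\operatorname{Tr}\Pi^n_{W,\delta}(f(m)),$$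 and $$|\mathcal M|\ge 2^{\,nI(P;W)-K\sqrt n}.$$ -/

import Mathlib

open scoped BigOperators ComplexOrder

noncomputable section

/-! Throughout, the Hilbert space is `ℂ^ι` for a finite type `ι`; the algebra of operators on it is
`Matrix ι ι ℂ`.  The tensor power of `ℂ^ι` over a finite index set `I` is `ℂ^(I → ι)`, with the
product basis indexed by `I → ι`. -/

/-- Quantum states (density operators) on `ℂ^ι`. -/
structure DensityMatrix (ι : Type*) [Fintype ι] where
  mat : Matrix ι ι ℂ
  posSemidef : mat.PosSemidef
  trace_eq_one : mat.trace = 1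

/-- The von Neumann entropy in bits: the Shannon entropy of the list of eigenvalues. -/
def vnEntropy {ι : Type*} [Fintype ι] [DecidableEq ι] (ρ : DensityMatrix ι) : ℝ :=
  ∑ j, Real.negMulLog (ρ.posSemidef.isHermitian.eigenvalues j) / Real.log 2

/-- The tensor product operator `⨂ i, A i` on the tensor power indexed by `I`. -/
def tensorOp {I ι : Type*} [Fintype I] (A : I → Matrix ι ι ℂ) : Matrix (I → ι) (I → ι) ℂ :=
  Matrix.of fun s t => ∏ i, A i (s i) (t i)

/-- A classical-quantum (discrete memoryless) channel: a map from the alphabet into the states. -/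
abbrev CQChannel (X ι : Type*) [Fintype ι] : Type _ := X → DensityMatrix ι

/-- The average state `∑ x, P x • W x`. -/
def avgState {X ι : Type*} [Fintype X] [Fintype ι] (P : stdSimplex ℝ X) (W : CQChannel X ι) :
    DensityMatrix ι where
  mat := ∑ x, ((P.1 x : ℝ) : ℂ) • (W x).mat
  posSemidef := Matrix.posSemidef_sum _ fun x _ =>
    (W x).posSemidef.smul (Complex.zero_le_real.mpr (P.2.1 x))
  trace_eq_one := by
    simp only [Matrix.trace_sum, Matrix.trace_smul, DensityMatrix.trace_eq_one, smul_eq_mul,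
      mul_one]
    exact_mod_cast P.2.2

/-- The conditional von Neumann entropy `H(W|P)`. -/
def condEntropy {X ι : Type*} [Fintype X] [Fintype ι] [DecidableEq ι]
    (P : stdSimplex ℝ X) (W : CQChannel X ι) : ℝ :=
  ∑ x, P.1 x * vnEntropy (W x)

/-- The mutual information `I(P;W) = H(PW) - H(W|P)`, in bits. -/
def mutualInfo {X ι : Type*} [Fintype X] [Fintype ι] [DecidableEq ι]
    (P : stdSimplex ℝ X) (W : CQChannel X ι) : ℝ :=
  vnEntropy (avgState P W) - condEntropy P W

/-- The product probability `P^n(A)` of a set `A` of sequences. -/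
def prodProb {X : Type*} [Fintype X] (P : stdSimplex ℝ X) {n : ℕ}
    (A : Finset (Fin n → X)) : ℝ :=
  ∑ x ∈ A, ∏ i, P.1 (x i)

/-- The channel output `W_{x₁} ⊗ ⋯ ⊗ W_{xₙ}` for an input sequence. -/
def outputOp {X ι : Type*} [Fintype ι] (W : CQChannel X ι) {n : ℕ} (x : Fin n → X) :
    Matrix (Fin n → ι) (Fin n → ι) ℂ :=
  tensorOp fun i => (W (x i)).mat

/-- A diagonalization `ρ = ∑ j, R j • π j` into rank-one projectors `π j` onto the vectors of an
orthonormal basis. -/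
structure Diagonalization {ι : Type*} [Fintype ι] (ρ : DensityMatrix ι) where
  weight : ι → ℝ
  basis : OrthonormalBasis ι ℂ (EuclideanSpace ℂ ι)
  mat_eq : ρ.mat =
    ∑ j, (weight j : ℂ) • Matrix.vecMulVec (basis j).ofLp (star (basis j).ofLp)

/-- The rank-one eigenprojector `π j` of a diagonalization. -/
def Diagonalization.proj {ι : Type*} [Fintype ι] {ρ : DensityMatrix ι} (Δ : Diagonalization ρ)
    (j : ι) : Matrix ι ι ℂ :=
  Matrix.vecMulVec (Δ.basis j).ofLp (star (Δ.basis j).ofLp)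

open Classical in
/-- The variance-typical sequences, indexed by `I`, of approximate type `R` with constant `δ`. -/
def typicalSeq (I : Type*) [Fintype I] {J : Type*} [Fintype J] (R : J → ℝ) (δ : ℝ) :
    Finset (I → J) :=
  Finset.univ.filter fun s => ∀ j,
    |(Fintype.card {i // s i = j} : ℝ) - Fintype.card I * R j| ≤
      δ * √(Fintype.card I) * √(R j * (1 - R j))

/-- The variance-typical projector of `ρ` with constant `δ`, on the tensor power indexed by `I`. -/
def typicalProj (I : Type*) [Fintype I] {ι : Type*} [Fintype ι] {ρ : DensityMatrix ι}
    (Δ : Diagonalization ρ) (δ : ℝ) : Matrix (I → ι) (I → ι) ℂ :=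
  ∑ s ∈ typicalSeq I Δ.weight δ, tensorOp fun i => Δ.proj (s i)

/-- The conditional variance-typical projector of `W` given `x` with constant `δ`: the tensor
product, over the letters `y` of the alphabet, of the variance-typical projectors of `W y` on the
tensor factors at the positions `{i | x i = y}`. -/
def condTypicalProj {X ι : Type*} [Fintype X] [DecidableEq X] [Fintype ι]
    {W : CQChannel X ι} (Δ : ∀ y, Diagonalization (W y)) (δ : ℝ) {n : ℕ} (x : Fin n → X) :
    Matrix (Fin n → ι) (Fin n → ι) ℂ :=
  Matrix.of fun s t =>
    ∏ y, typicalProj {i // x i = y} (Δ y) δ (fun i => s i.1) (fun i => t i.1)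

/-- An `n`-block code: a finite set `msgs` of messages inside a finite set `Outcome` of decoding
outcomes, an encoding of the messages, and an observable indexed by `Outcome`. -/
structure BlockCode (X ι : Type*) [Fintype ι] [DecidableEq ι] (n : ℕ) where
  Outcome : Type
  [fintypeOutcome : Fintype Outcome]
  msgs : Finset Outcome
  encode : msgs → Fin n → X
  dec : Outcome → Matrix (Fin n → ι) (Fin n → ι) ℂ
  dec_posSemidef : ∀ m, (dec m).PosSemidef
  dec_sum : ∑ m, dec m = 1

/-- The maximum error probability of a code (`0` if there are no messages). -/
def BlockCode.errorProb {X ι : Type*} [Fintype ι] [DecidableEq ι] {n : ℕ}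
    (C : BlockCode X ι n) (W : CQChannel X ι) : ℝ :=
  ⨆ m : C.msgs, (1 - (outputOp W (C.encode m) * C.dec m).trace.re)

/-- `(n,lam)`-codes. -/
def BlockCode.IsCode {X ι : Type*} [Fintype ι] [DecidableEq ι] {n : ℕ}
    (C : BlockCode X ι n) (W : CQChannel X ι) (lam : ℝ) : Prop :=
  C.errorProb W ≤ lam

end

/-!
The code is built greedily. Let `A'` be the part of `A` consisting of sequences that are
variance-typical for `P`; by Chebyshev's inequality its probability is at least `τ / 2`. Suppose
that codewords in `A'` with decoding operators `D m` have been chosen, let `B = ∑ m, D m ≤ 1`, and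
let `η = lam ^ 2 / 16`.

* If the output `W_x` of some `x ∈ A'` satisfies `Tr (W_x B) ≤ η`, then `x` is added to the code,
  with the operator `√(1 - B) Π √(1 - B)`, where `Π` is the conditional typical projector of `x`
  (`PartialCode.exists_succ`). It fits next to `B`, its trace is at most that of `Π`, and it still
  detects `W_x`: this is the gentle measurement principle, proved in
  `exists_compressed_projector` directly from operator inequalities, without the trace norm.
* Otherwise `Tr (W_x B) ≥ η` for all `x ∈ A'`, so that `Tr (ρ ^ ⊗n B) ≥ η τ / 2` for the average
  state `ρ`. Restricted to the typical sequences of the eigenvalues of `ρ`, this forces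
  `Tr B ≥ exp (n H(ρ) - O(√n))` (`le_trace_of_le_trace_tensorOp_mul`). On the other hand each
  decoding operator has trace at most `Tr Π ≤ exp (n H(W|P) + O(√n))`
  (`re_trace_condTypicalProj_le`). Hence there are at least `exp (n I(P;W) - O(√n))` codewords
  already (`PartialCode.le_card_of_forall_detected`).

Both trace estimates are classical once the tensor powers are written in a product eigenbasis: the
typical projectors are spans of product basis vectors (`condTypicalProj_eq_spanProj`), and the
log-likelihood of a variance-typical sequence is within `O(√n)` of minus its entropy
(`abs_sum_log_add_entropy_le`), because `√r |log r|` is bounded on `[0, 1]`. Entropies are computed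
in nats; `Diagonalization.vnEntropy_eq` converts them to bits.
-/

noncomputable section

/-! ### Product distributions and variance-typical sequences -/

section Classical

variable {I J Y : Type*} [Fintype I] [Fintype J] [DecidableEq Y]

theorem le_one_of_sum_eq_one {r : J → ℝ} (h0 : ∀ j, 0 ≤ r j) (h1 : ∑ j, r j = 1) (j : J) :
    r j ≤ 1 :=
  h1 ▸ Finset.single_le_sum (fun j _ => h0 j) (Finset.mem_univ j)

/-- The Shannon entropy, in nats. -/
def shannonNat (r : J → ℝ) : ℝ := ∑ j, Real.negMulLog (r j)

theorem shannonNat_nonneg {r : J → ℝ} (h0 : ∀ j, 0 ≤ r j) (h1 : ∑ j, r j = 1) :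
    0 ≤ shannonNat r :=
  Finset.sum_nonneg fun j _ => Real.negMulLog_nonneg (h0 j) (le_one_of_sum_eq_one h0 h1 j)

theorem shannonNat_le_card {r : J → ℝ} (h0 : ∀ j, 0 ≤ r j) :
    shannonNat r ≤ Fintype.card J := by
  calc shannonNat r ≤ ∑ _j : J, (1 : ℝ) := Finset.sum_le_sum fun j _ => ?_
    _ = _ := by simp
  rcases (h0 j).eq_or_lt with h | h
  · simp [← h]
  · have := Real.one_sub_inv_le_log_of_pos h
    have h2 := mul_le_mul_of_nonneg_left this h.le
    rw [mul_sub, mul_inv_cancel₀ h.ne'] at h2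
    rw [Real.negMulLog]
    linarith

/-- The bound `√r |log r| ≤ 2`, in the form that controls the fluctuation of a log-likelihood. -/
theorem sqrt_mul_one_sub_mul_abs_log_le {r : ℝ} (h0 : 0 ≤ r) (h1 : r ≤ 1) :
    √(r * (1 - r)) * |Real.log r| ≤ 2 := by
  rcases h0.eq_or_lt with h | h
  · simp [← h]
  · have h2 := Real.abs_log_mul_self_rpow_lt r (1 / 2) h h1 (by norm_num)
    rw [← Real.sqrt_eq_rpow, abs_mul, abs_of_nonneg (Real.sqrt_nonneg r)] at h2
    have h3 : √(r * (1 - r)) ≤ √r := Real.sqrt_le_sqrt (by nlinarith)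
    have h4 := mul_le_mul_of_nonneg_right h3 (abs_nonneg (Real.log r))
    norm_num at h2
    linarith

/-- The number of positions with label `y`. -/
def labelCount (c : I → Y) (y : Y) : ℕ := (Finset.univ.filter fun i => c i = y).card

theorem labelCount_le (c : I → Y) (y : Y) : labelCount c y ≤ Fintype.card I :=
  Finset.card_le_univ _

variable [DecidableEq I]

theorem sum_prod_weight_eq_one {w : I → J → ℝ} (hw : ∀ i, ∑ j, w i j = 1) :
    ∑ v : I → J, ∏ i, w i (v i) = 1 := by
  rw [← Fintype.prod_sum]
  simp [hw]

theorem sum_prod_weight_mul_mul {w g : I → J → ℝ} (hw : ∀ i, ∑ j, w i j = 1)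
    (hg : ∀ i, ∑ j, w i j * g i j = 0) (i k : I) :
    ∑ v : I → J, (∏ l, w l (v l)) * (g i (v i) * g k (v k)) =
      if i = k then ∑ j, w i j * g i j ^ 2 else 0 := by
  have h : ∀ v : I → J, (∏ l, w l (v l)) * (g i (v i) * g k (v k)) =
      ∏ l, (w l (v l) * ((if l = i then g l (v l) else 1) * (if l = k then g l (v l) else 1))) := by
    intro v
    simp_rw [Finset.prod_mul_distrib]
    simp
  simp_rw [h]
  rw [← Fintype.prod_sum fun l j =>
    w l j * ((if l = i then g l j else 1) * (if l = k then g l j else 1))]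
  split_ifs with hik
  · subst hik
    rw [Finset.prod_eq_single i]
    · simp [sq]
    · intro l _ hl
      simp [hl, hw]
    · simp
  · apply Finset.prod_eq_zero (Finset.mem_univ i)
    simp [hik, hg]

/-- The variance of a sum of independent centred variables is the sum of the variances. -/
theorem sum_prod_weight_mul_sq_sum {w g : I → J → ℝ} (hw : ∀ i, ∑ j, w i j = 1)
    (hg : ∀ i, ∑ j, w i j * g i j = 0) :
    ∑ v : I → J, (∏ l, w l (v l)) * (∑ i, g i (v i)) ^ 2 = ∑ i, ∑ j, w i j * g i j ^ 2 := by
  simp_rw [sq (∑ i, g i _), Finset.sum_mul_sum, Finset.mul_sum]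
  rw [Finset.sum_comm]
  refine Finset.sum_congr rfl fun i _ => ?_
  rw [Finset.sum_comm]
  simp_rw [sum_prod_weight_mul_mul hw hg]
  simp

variable [DecidableEq J]

/-- The number of positions with label `y` at which the sequence `v` has the letter `j`. -/
def jointCount (c : I → Y) (v : I → J) (y : Y) (j : J) : ℕ :=
  (Finset.univ.filter fun i => c i = y ∧ v i = j).card

/-- Variance-typicality of `v` for the letter `j` on the positions with label `y`. -/
def IsTypicalAt (c : I → Y) (R : Y → J → ℝ) (δ : ℝ) (y : Y) (j : J) (v : I → J) : Prop :=
  |(jointCount c v y j : ℝ) - labelCount c y * R y j| ≤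
    δ * √(labelCount c y) * √(R y j * (1 - R y j))

open Classical in
/-- The sequences that are variance-typical for `R y` on the positions with label `y`, for every
label `y`.  With `Y = Unit` these are the variance-typical sequences of a single distribution. -/
def condTypicalSeq (c : I → Y) (R : Y → J → ℝ) (δ : ℝ) : Finset (I → J) :=
  Finset.univ.filter fun v => ∀ y j, IsTypicalAt c R δ y j v

theorem mem_condTypicalSeq {c : I → Y} {R : Y → J → ℝ} {δ : ℝ} {v : I → J} :
    v ∈ condTypicalSeq c R δ ↔ ∀ y j, IsTypicalAt c R δ y j v := by
  simp [condTypicalSeq]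

open Classical in
/-- Chebyshev's inequality for a letter count. If the variance vanishes, the deviating sequences
all have probability zero. -/
theorem sum_not_isTypicalAt_le {R : Y → J → ℝ} (h0 : ∀ y j, 0 ≤ R y j)
    (h1 : ∀ y, ∑ j, R y j = 1) (c : I → Y) {δ : ℝ} (hδ : 0 < δ) (y : Y) (j : J) :
    ∑ v with ¬ IsTypicalAt c R δ y j v, ∏ i, R (c i) (v i) ≤ 1 / δ ^ 2 := by
  set g : I → J → ℝ := fun i k =>
    if c i = y then (if k = j then 1 else 0) - R y j else 0 with hgdef
  have hg : ∀ i, ∑ k, R (c i) k * g i k = 0 := by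
    intro i
    by_cases hi : c i = y
    · simp [hgdef, hi, mul_sub, Finset.sum_sub_distrib, ← Finset.sum_mul, h1]
    · simp [hgdef, hi]
  have hvar : ∀ i, ∑ k, R (c i) k * g i k ^ 2 = if c i = y then R y j * (1 - R y j) else 0 := by
    intro i
    by_cases hi : c i = y
    · have : ∀ k, R y k * ((if k = j then 1 else 0) - R y j) ^ 2 =
          (if k = j then R y k * (1 - 2 * R y j) else 0) + R y k * R y j ^ 2 := by
        intro k
        split_ifs <;> ring
      simp only [hgdef, hi, if_true, this, Finset.sum_add_distrib, ← Finset.sum_mul, h1]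
      simp
      ring
    · simp [hgdef, hi]
  set q : ℝ := labelCount c y * (R y j * (1 - R y j)) with hq
  have hmom := sum_prod_weight_mul_sq_sum (fun i => h1 (c i)) hg
  have hsum : ∀ v : I → J, ∑ i, g i (v i) = (jointCount c v y j : ℝ) - labelCount c y * R y j := by
    intro v
    have : ∀ i, g i (v i) =
        (if c i = y ∧ v i = j then 1 else 0) - (if c i = y then R y j else 0) := by
      intro i
      by_cases hi : c i = y <;> simp [hgdef, hi]
    simp_rw [this, Finset.sum_sub_distrib]
    simp [jointCount, labelCount, ← Finset.sum_filter]
  have hR1 := le_one_of_sum_eq_one (h0 y) (h1 y) j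
  have hv0 : 0 ≤ R y j * (1 - R y j) := mul_nonneg (h0 y j) (by linarith)
  have hq0 : 0 ≤ q := mul_nonneg (Nat.cast_nonneg _) hv0
  have hmom' : ∑ v : I → J, (∏ i, R (c i) (v i)) *
      ((jointCount c v y j : ℝ) - labelCount c y * R y j) ^ 2 = q := by
    simp_rw [← hsum]
    rw [hmom]
    simp_rw [hvar, ← Finset.sum_filter]
    simp [hq, labelCount]
  have hp0 : ∀ v : I → J, 0 ≤ ∏ i, R (c i) (v i) := fun v => Finset.prod_nonneg fun i _ => h0 _ _
  have hdev : ∀ v : I → J, ¬ IsTypicalAt c R δ y j v →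
      δ ^ 2 * q < ((jointCount c v y j : ℝ) - labelCount c y * R y j) ^ 2 := by
    intro v hv
    rw [IsTypicalAt, not_le] at hv
    rw [← sq_abs ((jointCount c v y j : ℝ) - _)]
    calc δ ^ 2 * q = (δ * √(labelCount c y) * √(R y j * (1 - R y j))) ^ 2 := by
          rw [mul_pow, mul_pow, Real.sq_sqrt (Nat.cast_nonneg _), Real.sq_sqrt hv0, hq]; ring
      _ < _ := pow_lt_pow_left₀ hv (by positivity) two_ne_zero
  rcases hq0.eq_or_lt with hqz | hqpos
  · have hz : ∀ v : I → J, ¬ IsTypicalAt c R δ y j v → ∏ i, R (c i) (v i) = 0 := by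
      intro v hv
      have h2 := (Finset.sum_eq_zero_iff_of_nonneg
        (fun v _ => mul_nonneg (hp0 v) (sq_nonneg _))).1 (hmom'.trans hqz.symm) v
        (Finset.mem_univ v)
      have h3 := hdev v hv
      rw [← hqz, mul_zero] at h3
      exact (mul_eq_zero.1 h2).resolve_right h3.ne'
    rw [Finset.sum_eq_zero fun v hv => hz v (Finset.mem_filter.1 hv).2]
    positivity
  · rw [le_div_iff₀ (by positivity)]
    have : (∑ v with ¬ IsTypicalAt c R δ y j v, ∏ i, R (c i) (v i)) * (δ ^ 2 * q) ≤ q := by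
      conv_rhs => rw [← hmom']
      rw [Finset.sum_mul]
      calc _ ≤ ∑ v with ¬ IsTypicalAt c R δ y j v, (∏ i, R (c i) (v i)) *
            ((jointCount c v y j : ℝ) - labelCount c y * R y j) ^ 2 :=
            Finset.sum_le_sum fun v hv =>
              mul_le_mul_of_nonneg_left (hdev v (Finset.mem_filter.1 hv).2).le (hp0 v)
        _ ≤ _ := Finset.sum_le_sum_of_subset_of_nonneg (Finset.subset_univ _)
            fun v _ _ => mul_nonneg (hp0 v) (sq_nonneg _)
    rw [← mul_assoc] at this
    exact (mul_le_iff_le_one_left hqpos).1 this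

/-- A typical sequence avoids the letters of weight zero. -/
theorem pos_of_mem_condTypicalSeq {R : Y → J → ℝ} (h0 : ∀ y j, 0 ≤ R y j) {c : I → Y} {δ : ℝ}
    {v : I → J} (hv : v ∈ condTypicalSeq c R δ) (i : I) : 0 < R (c i) (v i) := by
  refine (h0 _ _).lt_of_ne' fun hz => ?_
  have h := mem_condTypicalSeq.1 hv (c i) (v i)
  rw [IsTypicalAt, hz] at h
  simp only [mul_zero, sub_zero, zero_mul, Real.sqrt_zero, abs_nonpos_iff, Nat.cast_eq_zero,
    jointCount, Finset.card_eq_zero, Finset.filter_eq_empty_iff] at h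
  exact h (Finset.mem_univ i) ⟨rfl, rfl⟩

theorem prod_eq_exp_sum_log {R : Y → J → ℝ} (h0 : ∀ y j, 0 ≤ R y j) {c : I → Y} {δ : ℝ}
    {v : I → J} (hv : v ∈ condTypicalSeq c R δ) :
    ∏ i, R (c i) (v i) = Real.exp (∑ i, Real.log (R (c i) (v i))) := by
  rw [Real.exp_sum]
  exact Finset.prod_congr rfl fun i _ => (Real.exp_log (pos_of_mem_condTypicalSeq h0 hv i)).symm

variable [Fintype Y]

/-- A union bound over the labels and letters: for large `δ` the typical sequences carry almost
all of the probability. -/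
theorem one_sub_le_sum_condTypicalSeq {R : Y → J → ℝ} (h0 : ∀ y j, 0 ≤ R y j)
    (h1 : ∀ y, ∑ j, R y j = 1) (c : I → Y) {δ : ℝ} (hδ : 0 < δ) :
    1 - Fintype.card Y * Fintype.card J / δ ^ 2 ≤
      ∑ v ∈ condTypicalSeq c R δ, ∏ i, R (c i) (v i) := by
  classical
  have hp0 : ∀ v : I → J, 0 ≤ ∏ i, R (c i) (v i) := fun v => Finset.prod_nonneg fun i _ => h0 _ _
  have htot : ∑ v : I → J, ∏ i, R (c i) (v i) = 1 := sum_prod_weight_eq_one fun i => h1 (c i)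
  have hunion : ∑ v with ¬ v ∈ condTypicalSeq c R δ, ∏ i, R (c i) (v i) ≤
      ∑ y, ∑ j, ∑ v with ¬ IsTypicalAt c R δ y j v, ∏ i, R (c i) (v i) := by
    simp_rw [Finset.sum_filter]
    rw [← Fintype.sum_prod_type', Finset.sum_comm]
    refine Finset.sum_le_sum fun v _ => ?_
    by_cases hv : ∀ y j, IsTypicalAt c R δ y j v
    · rw [if_neg (not_not.2 (mem_condTypicalSeq.2 hv))]
      exact Finset.sum_nonneg fun p _ => by split_ifs <;> simp [hp0 v]
    · rw [if_pos (mem_condTypicalSeq.not.2 hv)]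
      push Not at hv
      obtain ⟨y, j, hyj⟩ := hv
      refine le_trans ?_ (Finset.single_le_sum (f := fun p : Y × J =>
        if ¬ IsTypicalAt c R δ p.1 p.2 v then ∏ i, R (c i) (v i) else 0) (fun p _ => ?_)
        (Finset.mem_univ (y, j)))
      · simp [hyj]
      · split_ifs <;> simp [hp0 v]
  have hbd : ∑ y, ∑ j, ∑ v with ¬ IsTypicalAt c R δ y j v, ∏ i, R (c i) (v i) ≤
      Fintype.card Y * Fintype.card J / δ ^ 2 := by
    calc _ ≤ ∑ _y : Y, ∑ _j : J, 1 / δ ^ 2 := Finset.sum_le_sum fun y _ =>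
          Finset.sum_le_sum fun j _ => sum_not_isTypicalAt_le h0 h1 c hδ y j
      _ = _ := by simp; ring
  have hsplit := Finset.sum_filter_add_sum_filter_not Finset.univ
    (fun v : I → J => v ∈ condTypicalSeq c R δ) fun v => ∏ i, R (c i) (v i)
  have : Finset.univ.filter (fun v : I → J => v ∈ condTypicalSeq c R δ) = condTypicalSeq c R δ := by
    ext; simp
  rw [this, htot] at hsplit
  linarith

/-- The log-likelihood of a typical sequence is minus its conditional entropy, up to an error of
the order of the square root of the length. -/
theorem abs_sum_log_add_entropy_le {R : Y → J → ℝ} (h0 : ∀ y j, 0 ≤ R y j)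
    (h1 : ∀ y, ∑ j, R y j = 1) {c : I → Y} {δ : ℝ} (hδ : 0 < δ) {v : I → J}
    (hv : v ∈ condTypicalSeq c R δ) :
    |∑ i, Real.log (R (c i) (v i)) + ∑ y, labelCount c y * shannonNat (R y)| ≤
      2 * Fintype.card Y * Fintype.card J * δ * √(Fintype.card I) := by
  have hlog : ∑ i, Real.log (R (c i) (v i)) =
      ∑ y, ∑ j, (jointCount c v y j : ℝ) * Real.log (R y j) := by
    have := Finset.sum_fiberwise' Finset.univ (fun i => (c i, v i))
      fun p : Y × J => Real.log (R p.1 p.2)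
    rw [← this, Fintype.sum_prod_type]
    simp [jointCount]
  have heq : ∑ i, Real.log (R (c i) (v i)) + ∑ y, labelCount c y * shannonNat (R y) =
      ∑ y, ∑ j, ((jointCount c v y j : ℝ) - labelCount c y * R y j) * Real.log (R y j) := by
    rw [hlog, ← Finset.sum_add_distrib]
    refine Finset.sum_congr rfl fun y _ => ?_
    rw [shannonNat, Finset.mul_sum, ← Finset.sum_add_distrib]
    refine Finset.sum_congr rfl fun j _ => ?_
    rw [Real.negMulLog]
    ring
  rw [heq]
  calc _ ≤ ∑ _y : Y, ∑ _j : J, 2 * δ * √(Fintype.card I) := by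
        refine (Finset.abs_sum_le_sum_abs _ _).trans (Finset.sum_le_sum fun y _ => ?_)
        refine (Finset.abs_sum_le_sum_abs _ _).trans (Finset.sum_le_sum fun j _ => ?_)
        rw [abs_mul]
        calc _ ≤ (δ * √(labelCount c y) * √(R y j * (1 - R y j))) * |Real.log (R y j)| :=
              mul_le_mul_of_nonneg_right (mem_condTypicalSeq.1 hv y j) (abs_nonneg _)
          _ = δ * √(labelCount c y) * (√(R y j * (1 - R y j)) * |Real.log (R y j)|) := by ring
          _ ≤ δ * √(Fintype.card I) * 2 := by
              gcongr
              · exact labelCount_le c y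
              · exact sqrt_mul_one_sub_mul_abs_log_le (h0 y j)
                  (le_one_of_sum_eq_one (h0 y) (h1 y) j)
          _ = _ := by ring
    _ = _ := by simp; ring

/-- Each typical sequence has a large probability, so there cannot be many of them. -/
theorem card_condTypicalSeq_le {R : Y → J → ℝ} (h0 : ∀ y j, 0 ≤ R y j)
    (h1 : ∀ y, ∑ j, R y j = 1) (c : I → Y) {δ : ℝ} (hδ : 0 < δ) :
    ((condTypicalSeq c R δ).card : ℝ) ≤ Real.exp (∑ y, labelCount c y * shannonNat (R y) +
      2 * Fintype.card Y * Fintype.card J * δ * √(Fintype.card I)) := by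
  set E := ∑ y, labelCount c y * shannonNat (R y) +
      2 * Fintype.card Y * Fintype.card J * δ * √(Fintype.card I) with hE
  have h : ((condTypicalSeq c R δ).card : ℝ) * Real.exp (-E) ≤ 1 := by
    rw [← nsmul_eq_mul, ← sum_prod_weight_eq_one fun i => h1 (c i)]
    refine (Finset.card_nsmul_le_sum _ _ _ fun v hv => ?_).trans
      (Finset.sum_le_sum_of_subset_of_nonneg (Finset.subset_univ _)
        fun v _ _ => Finset.prod_nonneg fun i _ => h0 _ _)
    rw [prod_eq_exp_sum_log h0 hv, Real.exp_le_exp]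
    have := abs_le.1 (abs_sum_log_add_entropy_le h0 h1 hδ hv)
    linarith [this.1]
  rw [Real.exp_neg, ← div_eq_mul_inv, div_le_one (Real.exp_pos _)] at h
  exact h

theorem prod_le_exp_of_mem_condTypicalSeq {R : Y → J → ℝ} (h0 : ∀ y j, 0 ≤ R y j)
    (h1 : ∀ y, ∑ j, R y j = 1) {c : I → Y} {δ : ℝ} (hδ : 0 < δ) {v : I → J}
    (hv : v ∈ condTypicalSeq c R δ) :
    ∏ i, R (c i) (v i) ≤ Real.exp (-(∑ y, labelCount c y * shannonNat (R y)) +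
      2 * Fintype.card Y * Fintype.card J * δ * √(Fintype.card I)) := by
  rw [prod_eq_exp_sum_log h0 hv, Real.exp_le_exp]
  have := abs_le.1 (abs_sum_log_add_entropy_le h0 h1 hδ hv)
  linarith [this.2]

end Classical

/-! ### Traces of products of positive semidefinite matrices -/

section Trace

variable {κ : Type*} [Fintype κ]

open scoped MatrixOrder in
theorem re_trace_mul_nonneg {A B : Matrix κ κ ℂ} (hA : A.PosSemidef) (hB : B.PosSemidef) :
    0 ≤ (A * B).trace.re := by
  classical
  obtain ⟨C, rfl⟩ := CStarAlgebra.nonneg_iff_eq_star_mul_self.1 hA.nonneg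
  rw [Matrix.star_eq_conjTranspose]
  rw [Matrix.mul_assoc, Matrix.trace_mul_comm]
  exact (Complex.le_def.1 (hB.mul_mul_conjTranspose_same C).trace_nonneg).1

theorem re_trace_mul_le {A B C : Matrix κ κ ℂ} (hA : A.PosSemidef) (hBC : (C - B).PosSemidef) :
    (A * B).trace.re ≤ (A * C).trace.re := by
  have := re_trace_mul_nonneg hA hBC
  rw [Matrix.mul_sub, Matrix.trace_sub, Complex.sub_re] at this
  linarith

theorem re_trace_nonneg {A : Matrix κ κ ℂ} (hA : A.PosSemidef) : 0 ≤ A.trace.re :=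
  (Complex.le_def.1 hA.trace_nonneg).1

end Trace

/-! ### Tensor products of operators -/

section Tensor

variable {I ι : Type*} [Fintype I]

theorem tensorOp_mul [DecidableEq I] [Fintype ι] (A B : I → Matrix ι ι ℂ) :
    tensorOp A * tensorOp B = tensorOp fun i => A i * B i := by
  ext s t
  simp only [tensorOp, Matrix.mul_apply, Matrix.of_apply, Fintype.prod_sum,
    ← Finset.prod_mul_distrib]

theorem trace_tensorOp [DecidableEq I] [Fintype ι] (A : I → Matrix ι ι ℂ) :
    (tensorOp A).trace = ∏ i, (A i).trace := by
  simp only [Matrix.trace, Matrix.diag_apply, tensorOp, Matrix.of_apply, Fintype.prod_sum]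

theorem tensorOp_sum [DecidableEq I] {J : Type*} [Fintype J] (A : I → J → Matrix ι ι ℂ) :
    tensorOp (fun i => ∑ j, A i j) = ∑ v : I → J, tensorOp fun i => A i (v i) := by
  ext s t
  simp only [tensorOp, Matrix.sum_apply, Matrix.of_apply, Fintype.prod_sum]

theorem tensorOp_smul (c : I → ℂ) (A : I → Matrix ι ι ℂ) :
    tensorOp (fun i => c i • A i) = (∏ i, c i) • tensorOp A := by
  ext s t
  simp [tensorOp, Finset.prod_mul_distrib]

theorem conjTranspose_tensorOp (A : I → Matrix ι ι ℂ) :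
    (tensorOp A).conjTranspose = tensorOp fun i => (A i).conjTranspose := by
  ext s t
  simp [tensorOp, Matrix.conjTranspose_apply]

theorem tensorOp_one [DecidableEq ι] :
    tensorOp (fun _ : I => (1 : Matrix ι ι ℂ)) = 1 := by
  ext s t
  simp [tensorOp, Matrix.one_apply, Finset.prod_ite_zero, funext_iff]

theorem tensorOp_eq_zero {A : I → Matrix ι ι ℂ} {i : I} (h : A i = 0) : tensorOp A = 0 := by
  ext s t
  exact Finset.prod_eq_zero (Finset.mem_univ i) (by simp [h])

end Tensor

/-! ### Diagonalizations -/

namespace Diagonalization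

section

variable {ι : Type*} [Fintype ι] {ρ : DensityMatrix ι} (Δ : Diagonalization ρ)

/-- The matrix whose columns are the vectors of the diagonalizing basis. -/
def basisMatrix : Matrix ι ι ℂ := Matrix.of fun i j => Δ.basis j i

theorem conjTranspose_basisMatrix_mul [DecidableEq ι] :
    Δ.basisMatrix.conjTranspose * Δ.basisMatrix = 1 := by
  ext j k
  have := orthonormal_iff_ite.1 Δ.basis.orthonormal j k
  rw [EuclideanSpace.inner_eq_star_dotProduct] at this
  rw [Matrix.one_apply, ← this, Matrix.mul_apply, dotProduct]
  exact Finset.sum_congr rfl fun i _ => by simp [basisMatrix, mul_comm]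

theorem basisMatrix_mul_conjTranspose [DecidableEq ι] :
    Δ.basisMatrix * Δ.basisMatrix.conjTranspose = 1 :=
  mul_eq_one_comm.1 Δ.conjTranspose_basisMatrix_mul

theorem star_dotProduct_basis [DecidableEq ι] (j k : ι) :
    star (Δ.basis j).ofLp ⬝ᵥ (Δ.basis k).ofLp = if j = k then 1 else 0 := by
  rw [dotProduct_comm, ← EuclideanSpace.inner_eq_star_dotProduct]
  exact orthonormal_iff_ite.1 Δ.basis.orthonormal j k

theorem proj_mul_proj [DecidableEq ι] (j k : ι) :
    Δ.proj j * Δ.proj k = if j = k then Δ.proj j else 0 := by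
  rw [proj, proj, Matrix.vecMulVec_mul_vecMulVec, star_dotProduct_basis]
  split_ifs with h
  · subst h; simp
  · simp

theorem sum_proj [DecidableEq ι] : ∑ j, Δ.proj j = 1 := by
  rw [← Δ.basisMatrix_mul_conjTranspose]
  ext s t
  simp [Matrix.sum_apply, proj, Matrix.vecMulVec_apply, Matrix.mul_apply, basisMatrix]

theorem trace_proj (j : ι) : (Δ.proj j).trace = 1 := by
  classical
  rw [proj, Matrix.trace_vecMulVec, dotProduct_comm, star_dotProduct_basis, if_pos rfl]

theorem conjTranspose_proj (j : ι) : (Δ.proj j).conjTranspose = Δ.proj j := by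
  rw [proj, Matrix.conjTranspose_vecMulVec, star_star]

theorem mat_eq_sum_proj : ρ.mat = ∑ j, (Δ.weight j : ℂ) • Δ.proj j := Δ.mat_eq

theorem weight_nonneg (j : ι) : 0 ≤ Δ.weight j := by
  classical
  have h1 : Δ.proj j * ρ.mat * Δ.proj j = (Δ.weight j : ℂ) • Δ.proj j := by
    simp [Δ.mat_eq_sum_proj, Finset.mul_sum, proj_mul_proj]
  have h2 := ρ.posSemidef.mul_mul_conjTranspose_same (Δ.proj j)
  rw [Δ.conjTranspose_proj, h1] at h2
  simpa [Matrix.trace_smul, trace_proj] using re_trace_nonneg h2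

theorem sum_weight : ∑ j, Δ.weight j = 1 := by
  have h := ρ.trace_eq_one
  rw [Δ.mat_eq_sum_proj] at h
  simp only [Matrix.trace_sum, Matrix.trace_smul, trace_proj, smul_eq_mul, mul_one] at h
  exact_mod_cast h

/-- The entropy does not depend on the diagonalization, as the eigenvalues with multiplicities are
the roots of the characteristic polynomial. -/
theorem vnEntropy_eq [DecidableEq ι] : vnEntropy ρ = shannonNat Δ.weight / Real.log 2 := by
  have hρ : ρ.mat = Δ.basisMatrix *
      (Matrix.diagonal (fun j => (Δ.weight j : ℂ)) * Δ.basisMatrix.conjTranspose) := by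
    rw [Δ.mat_eq_sum_proj]
    ext s t
    rw [Matrix.sum_apply, Matrix.mul_apply]
    refine Finset.sum_congr rfl fun j _ => ?_
    simp [proj, Matrix.vecMulVec_apply, basisMatrix]
    ring
  have hroots := ρ.posSemidef.isHermitian.roots_charpoly_eq_eigenvalues
  have hchar : ρ.mat.charpoly = ∏ j, (Polynomial.X - Polynomial.C (Δ.weight j : ℂ)) := by
    rw [hρ, Matrix.charpoly_mul_comm, Matrix.mul_assoc, conjTranspose_basisMatrix_mul,
      Matrix.mul_one, Matrix.charpoly_diagonal]
  rw [hchar, Polynomial.roots_prod _ _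
    (Finset.prod_ne_zero_iff.2 fun j _ => Polynomial.X_sub_C_ne_zero _)] at hroots
  have h := congrArg (fun m : Multiset ℂ => (m.map fun z => Real.negMulLog z.re).sum) hroots
  simp only [Polynomial.roots_X_sub_C, Multiset.bind_singleton, Multiset.map_map,
    Function.comp_apply, Complex.ofReal_re] at h
  rw [vnEntropy, ← Finset.sum_div, shannonNat]
  congr 1
  exact h.symm

end

/-- The diagonalization furnished by the spectral theorem. -/
def ofEigenvectorBasis {ι : Type*} [Fintype ι] [DecidableEq ι] (ρ : DensityMatrix ι) :
    Diagonalization ρ where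
  weight := ρ.posSemidef.isHermitian.eigenvalues
  basis := ρ.posSemidef.isHermitian.eigenvectorBasis
  mat_eq := by
    conv_lhs => rw [ρ.posSemidef.isHermitian.spectral_theorem, Unitary.conjStarAlgAut_apply]
    ext s t
    rw [Matrix.mul_apply, Matrix.sum_apply]
    refine Finset.sum_congr rfl fun j _ => ?_
    simp [Matrix.vecMulVec_apply, Matrix.mul_diagonal, Matrix.star_apply]
    ring

end Diagonalization

/-! ### Product projectors and typical projectors -/

section SeqProj

variable {I ι : Type*} [Fintype I] [Fintype ι] {ρ : I → DensityMatrix ι}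
  (Δ : ∀ i, Diagonalization (ρ i))

/-- The projector onto the product basis vector labelled by the sequence `v`. -/
def seqProj (v : I → ι) : Matrix (I → ι) (I → ι) ℂ := tensorOp fun i => (Δ i).proj (v i)

theorem conjTranspose_seqProj (v : I → ι) : (seqProj Δ v).conjTranspose = seqProj Δ v := by
  simp [seqProj, conjTranspose_tensorOp, Diagonalization.conjTranspose_proj]

/-- The projector onto the span of the product basis vectors labelled by `T`. -/
def spanProj (T : Finset (I → ι)) : Matrix (I → ι) (I → ι) ℂ := ∑ v ∈ T, seqProj Δ v

theorem isHermitian_spanProj (T : Finset (I → ι)) : (spanProj Δ T).IsHermitian := by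
  rw [Matrix.IsHermitian, spanProj, Matrix.conjTranspose_sum]
  simp_rw [conjTranspose_seqProj]

variable [DecidableEq I]

theorem trace_seqProj (v : I → ι) : (seqProj Δ v).trace = 1 := by
  simp [seqProj, trace_tensorOp, Diagonalization.trace_proj]

theorem trace_spanProj (T : Finset (I → ι)) : (spanProj Δ T).trace = T.card := by
  simp [spanProj, Matrix.trace_sum, trace_seqProj]

theorem tensorOp_mat_eq_sum_seqProj :
    tensorOp (fun i => (ρ i).mat) =
      ∑ v, ((∏ i, (Δ i).weight (v i) : ℝ) : ℂ) • seqProj Δ v := by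
  conv_lhs => rw [funext fun i => (Δ i).mat_eq_sum_proj]
  rw [tensorOp_sum]
  simp_rw [tensorOp_smul, seqProj]
  push_cast
  rfl

theorem re_trace_tensorOp_mul (B : Matrix (I → ι) (I → ι) ℂ) :
    (tensorOp (fun i => (ρ i).mat) * B).trace.re =
      ∑ v, (∏ i, (Δ i).weight (v i)) * (seqProj Δ v * B).trace.re := by
  rw [tensorOp_mat_eq_sum_seqProj Δ]
  simp only [Finset.sum_mul, Matrix.smul_mul, Matrix.trace_sum, Matrix.trace_smul, Complex.re_sum,
    smul_eq_mul, Complex.re_ofReal_mul]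

variable [DecidableEq ι]

theorem seqProj_mul_seqProj (v w : I → ι) :
    seqProj Δ v * seqProj Δ w = if v = w then seqProj Δ v else 0 := by
  rw [seqProj, seqProj, tensorOp_mul]
  split_ifs with h
  · subst h
    simp [Diagonalization.proj_mul_proj]
  · obtain ⟨i, hi⟩ := Function.ne_iff.1 h
    exact tensorOp_eq_zero (i := i) (by rw [Diagonalization.proj_mul_proj, if_neg hi])

theorem posSemidef_seqProj (v : I → ι) : (seqProj Δ v).PosSemidef := by
  have h := Matrix.posSemidef_conjTranspose_mul_self (seqProj Δ v)
  rwa [conjTranspose_seqProj, seqProj_mul_seqProj, if_pos rfl] at h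

theorem sum_seqProj : ∑ v, seqProj Δ v = 1 := by
  simp_rw [seqProj]
  rw [← tensorOp_sum fun i j => (Δ i).proj j]
  simp_rw [Diagonalization.sum_proj, tensorOp_one]

theorem seqProj_mul_spanProj (v : I → ι) (T : Finset (I → ι)) :
    seqProj Δ v * spanProj Δ T = if v ∈ T then seqProj Δ v else 0 := by
  simp [spanProj, Finset.mul_sum, seqProj_mul_seqProj]

theorem spanProj_mul_self (T : Finset (I → ι)) : spanProj Δ T * spanProj Δ T = spanProj Δ T := by
  simp only [spanProj, Finset.sum_mul, Finset.mul_sum, seqProj_mul_seqProj]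
  refine Finset.sum_congr rfl fun v hv => ?_
  simp [hv]

theorem re_trace_eq_sum_seqProj (B : Matrix (I → ι) (I → ι) ℂ) :
    B.trace.re = ∑ v, (seqProj Δ v * B).trace.re := by
  conv_lhs => rw [← Matrix.one_mul B, ← sum_seqProj Δ]
  simp only [Finset.sum_mul, Matrix.trace_sum, Complex.re_sum]

theorem re_trace_tensorOp_mul_spanProj (T : Finset (I → ι)) :
    (tensorOp (fun i => (ρ i).mat) * spanProj Δ T).trace.re =
      ∑ v ∈ T, ∏ i, (Δ i).weight (v i) := by
  rw [re_trace_tensorOp_mul Δ, ← Finset.univ_inter T, ← Finset.sum_ite_mem]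
  refine Finset.sum_congr rfl fun v _ => ?_
  rw [Finset.univ_inter, seqProj_mul_spanProj]
  split_ifs <;> simp [trace_seqProj]

include Δ in
theorem posSemidef_tensorOp_mat : (tensorOp fun i => (ρ i).mat).PosSemidef := by
  rw [tensorOp_mat_eq_sum_seqProj Δ]
  exact Matrix.posSemidef_sum _ fun v _ => (posSemidef_seqProj Δ v).smul
    (Complex.zero_le_real.mpr (Finset.prod_nonneg fun i _ => (Δ i).weight_nonneg _))

end SeqProj

section CondTypicalProj

variable {X ι : Type*} [DecidableEq X] [Fintype ι] [DecidableEq ι]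

theorem mem_typicalSeq_restrict_iff (R : X → ι → ℝ) (δ : ℝ) {n : ℕ} (x : Fin n → X)
    (v : Fin n → ι) (y : X) :
    (fun i : {i // x i = y} => v i.1) ∈ typicalSeq {i // x i = y} (R y) δ ↔
      ∀ j, IsTypicalAt x R δ y j v := by
  have h1 : Fintype.card {i // x i = y} = labelCount x y := Fintype.card_subtype _
  have h2 : ∀ (j : ι) [Fintype {i : {i // x i = y} // v i.1 = j}],
      Fintype.card {i : {i // x i = y} // v i.1 = j} = jointCount x v y j := by
    intro j _
    rw [jointCount, ← Fintype.card_subtype]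
    exact Fintype.card_congr
      (Equiv.subtypeSubtypeEquivSubtypeInter (fun i => x i = y) fun i => v i = j)
  simp only [typicalSeq, Finset.mem_filter, Finset.mem_univ, true_and, h2, h1, IsTypicalAt]

variable [Fintype X]

/-- The tensor product of the typical projectors of the blocks is the span of the product basis
vectors that are typical on every block. -/
theorem condTypicalProj_eq_spanProj {W : CQChannel X ι} (Δ : ∀ y, Diagonalization (W y)) (δ : ℝ)
    {n : ℕ} (x : Fin n → X) :
    condTypicalProj Δ δ x =
      spanProj (fun i => Δ (x i)) (condTypicalSeq x (fun y => (Δ y).weight) δ) := by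
  classical
  let e : (Fin n → ι) ≃ (∀ y, {i // x i = y} → ι) :=
    { toFun := fun v _ i => v i.1
      invFun := fun u i => u (x i) ⟨i, rfl⟩
      left_inv := fun _ => rfl
      right_inv := fun u => by
        funext y ⟨i, hi⟩
        subst hi
        rfl }
  ext s t
  set C := condTypicalSeq x (fun y => (Δ y).weight) δ
  let T (y : X) := typicalSeq {i // x i = y} (Δ y).weight δ
  let F (y : X) (u : {i // x i = y} → ι) : ℂ := ∏ i, (Δ y).proj (u i) (s i.1) (t i.1)
  have hsplit : ∀ v : Fin n → ι, (∏ y, if e v y ∈ T y then F y (e v y) else 0) =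
      if v ∈ C then seqProj (fun i => Δ (x i)) v s t else 0 := by
    intro v
    rw [Fintype.prod_ite_zero]
    refine if_congr ?_ ?_ rfl
    · rw [mem_condTypicalSeq]
      exact forall_congr' fun y => mem_typicalSeq_restrict_iff (fun y => (Δ y).weight) δ x v y
    · have hF : ∀ y, F y (e v y) =
          ∏ i : {i // x i = y}, (Δ (x i.1)).proj (v i.1) (s i.1) (t i.1) := fun y =>
        Finset.prod_congr rfl fun i _ => by rw [i.2]; rfl
      simp_rw [hF]
      exact Fintype.prod_fiberwise x fun i => (Δ (x i)).proj (v i) (s i) (t i)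
  calc condTypicalProj Δ δ x s t = ∏ y, ∑ u ∈ T y, F y u := by
        simp only [condTypicalProj, typicalProj, Matrix.of_apply, Matrix.sum_apply, tensorOp, F, T]
    _ = ∏ y, ∑ u, if u ∈ T y then F y u else 0 := by simp
    _ = ∑ u : ∀ y, {i // x i = y} → ι, ∏ y, if u y ∈ T y then F y (u y) else 0 :=
        Fintype.prod_sum _
    _ = ∑ v, ∏ y, if e v y ∈ T y then F y (e v y) else 0 := (Equiv.sum_comp e _).symm
    _ = ∑ v, if v ∈ C then seqProj (fun i => Δ (x i)) v s t else 0 :=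
        Finset.sum_congr rfl fun v _ => hsplit v
    _ = _ := by simp [spanProj, Matrix.sum_apply]

end CondTypicalProj

/-! ### Gentle measurement -/

section Gentle

variable {κ : Type*} [Fintype κ] [DecidableEq κ]

/-- A positive semidefinite contraction `A` has a Hermitian square root `S` with `S ^ 2 ≤ S`. -/
theorem exists_sqrt_of_contraction {A : Matrix κ κ ℂ} (hA : A.PosSemidef)
    (hA1 : (1 - A).PosSemidef) :
    ∃ S : Matrix κ κ ℂ, S.IsHermitian ∧ S * S = A ∧ (S - S * S).PosSemidef := by
  set U : Matrix κ κ ℂ := (hA.isHermitian.eigenvectorUnitary : Matrix κ κ ℂ) with hU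
  set μ := hA.isHermitian.eigenvalues with hμ
  have hUU : U.conjTranspose * U = 1 := by
    rw [← Matrix.star_eq_conjTranspose]
    exact Unitary.coe_star_mul_self _
  have hspec : A = U * Matrix.diagonal (fun j => (μ j : ℂ)) * U.conjTranspose := by
    conv_lhs => rw [hA.isHermitian.spectral_theorem, Unitary.conjStarAlgAut_apply]
    rfl
  have hμ0 : ∀ j, 0 ≤ μ j := hA.eigenvalues_nonneg
  have hμ1 : ∀ j, μ j ≤ 1 := by
    have h := hA1.conjTranspose_mul_mul_same U
    have h2 : U.conjTranspose * (1 - A) * U = Matrix.diagonal fun j => ((1 - μ j : ℝ) : ℂ) := by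
      have h3 : U.conjTranspose * A * U = Matrix.diagonal fun j => (μ j : ℂ) := by
        rw [hspec]
        calc _ = (U.conjTranspose * U) * Matrix.diagonal (fun j => (μ j : ℂ)) *
              (U.conjTranspose * U) := by simp only [Matrix.mul_assoc]
          _ = _ := by rw [hUU, Matrix.one_mul, Matrix.mul_one]
      rw [Matrix.mul_sub, Matrix.sub_mul, Matrix.mul_one, hUU, h3, ← Matrix.diagonal_one,
        Matrix.diagonal_sub]
      simp
    rw [h2, Matrix.posSemidef_diagonal_iff] at h
    intro j
    have := Complex.zero_le_real.1 (h j)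
    linarith
  have hconj : ∀ f g : κ → ℂ, (U * Matrix.diagonal f * U.conjTranspose) *
      (U * Matrix.diagonal g * U.conjTranspose) =
      U * Matrix.diagonal (fun j => f j * g j) * U.conjTranspose := by
    intro f g
    calc _ = U * Matrix.diagonal f * (U.conjTranspose * U) * Matrix.diagonal g *
          U.conjTranspose := by simp only [Matrix.mul_assoc]
      _ = _ := by rw [hUU, Matrix.mul_one, Matrix.mul_assoc U, Matrix.diagonal_mul_diagonal]
  have hS2 : (U * Matrix.diagonal (fun j => ((√(μ j) : ℝ) : ℂ)) * U.conjTranspose) *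
      (U * Matrix.diagonal (fun j => ((√(μ j) : ℝ) : ℂ)) * U.conjTranspose) = A := by
    rw [hconj, hspec]
    congr 3
    funext j
    rw [← Complex.ofReal_mul, Real.mul_self_sqrt (hμ0 j)]
  refine ⟨U * Matrix.diagonal (fun j => ((√(μ j) : ℝ) : ℂ)) * U.conjTranspose, ?_, hS2, ?_⟩
  · exact Matrix.isHermitian_mul_mul_conjTranspose _
      (Matrix.isHermitian_diagonal_of_self_adjoint _ (by ext j; simp))
  · rw [hS2, hspec, ← Matrix.sub_mul, ← Matrix.mul_sub, Matrix.diagonal_sub]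
    refine Matrix.PosSemidef.mul_mul_conjTranspose_same ?_ U
    rw [Matrix.posSemidef_diagonal_iff]
    intro j
    rw [← Complex.ofReal_sub]
    refine Complex.zero_le_real.2 (sub_nonneg.2 (Real.le_sqrt_of_sq_le ?_))
    nlinarith [hμ0 j, hμ1 j]

/-- If a state `W` is almost contained in the range of a projector `Q` and is hardly detected by
`B`, then the part `D` of `Q` compressed by `√(1 - B)` fits next to `B` and still detects `W`. -/
theorem exists_compressed_projector {W B Q : Matrix κ κ ℂ} (hW : W.PosSemidef)
    (hB : B.PosSemidef) (hB1 : (1 - B).PosSemidef) (hQ : Q.IsHermitian) (hQQ : Q * Q = Q)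
    {ε η t : ℝ} (hWQ : 1 - ε ≤ (W * Q).trace.re) (hWB : (W * B).trace.re ≤ η)
    (ht0 : 0 < t) (ht1 : t ≤ 1) (hη : 0 ≤ η) (hε : 0 ≤ ε) :
    ∃ D : Matrix κ κ ℂ, D.PosSemidef ∧ (1 - (D + B)).PosSemidef ∧
      D.trace.re ≤ Q.trace.re ∧ 1 - t - ε - η / t ≤ (W * D).trace.re := by
  have hsub : (1 : Matrix κ κ ℂ) - (1 - B) = B := sub_sub_cancel _ _
  obtain ⟨S, hS, hSS, hSle⟩ := exists_sqrt_of_contraction hB1 (by rwa [hsub])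
  have hBS : B = 1 - S * S := by rw [hSS, hsub]
  have hQps : Q.PosSemidef := by
    have := Matrix.posSemidef_conjTranspose_mul_self Q
    rwa [hQ.eq, hQQ] at this
  have hQ1 : (1 - Q).PosSemidef := by
    have := Matrix.posSemidef_conjTranspose_mul_self (1 - Q)
    rw [Matrix.conjTranspose_sub, Matrix.conjTranspose_one, hQ.eq] at this
    have h2 : (1 - Q) * (1 - Q) = 1 - Q := by
      rw [sub_mul, mul_sub, mul_sub, hQQ]; simp
    rwa [h2] at this
  have hR : (1 - S).IsHermitian := Matrix.isHermitian_one.sub hS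
  refine ⟨S * Q * S, ?_, ?_, ?_, ?_⟩
  · have := hQps.mul_mul_conjTranspose_same S
    rwa [hS.eq] at this
  · have := hQ1.mul_mul_conjTranspose_same S
    rw [hS.eq] at this
    convert this using 1
    rw [hBS]
    noncomm_ring
  · rw [Matrix.mul_assoc, Matrix.trace_mul_comm, Matrix.mul_assoc, hSS, Matrix.mul_sub,
      Matrix.mul_one, Matrix.trace_sub, Complex.sub_re]
    linarith [re_trace_mul_nonneg hQps hB]
  · -- With `R = 1 - S`: `S Q S - (1 - t) Q - (1 - 1/t) R Q R = (t - R) Q (t - R) / t ≥ 0`, and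
    -- `R Q R ≤ R ^ 2 ≤ B` since `S ^ 2 ≤ S`.
    set R := 1 - S with hRdef
    have hRB : (B - R * Q * R).PosSemidef := by
      have h1 := hQ1.mul_mul_conjTranspose_same R
      rw [hR.eq] at h1
      have h2 := (h1.add hSle).add hSle
      convert h2 using 1
      rw [hBS, hRdef]
      noncomm_ring
    have hcs : (S * Q * S -
        (((1 - t : ℝ) : ℂ) • Q + ((1 - 1 / t : ℝ) : ℂ) • (R * Q * R))).PosSemidef := by
      have h1 := hQps.mul_mul_conjTranspose_same (((t : ℝ) : ℂ) • (1 : Matrix κ κ ℂ) - R)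
      rw [Matrix.conjTranspose_sub, Matrix.conjTranspose_smul, hR.eq,
        Matrix.conjTranspose_one] at h1
      have h2 := h1.smul (Complex.zero_le_real.2 (one_div_nonneg.2 ht0.le))
      convert h2 using 1
      have hS' : S = 1 - R := by rw [hRdef]; abel
      have htc : (t : ℂ) ≠ 0 := by exact_mod_cast ht0.ne'
      have ht2 : (t : ℂ)⁻¹ * (t * t) = t := by field_simp
      rw [hS']
      simp only [Complex.star_def, Complex.conj_ofReal, sub_mul, mul_sub, Matrix.smul_mul,
        Matrix.mul_smul, Matrix.one_mul, Matrix.mul_one, smul_sub, smul_smul, one_div,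
        Complex.ofReal_sub, Complex.ofReal_one, Complex.ofReal_inv, sub_smul, one_smul, ht2,
        inv_mul_cancel₀ htc, mul_assoc]
      abel
    have h1 := re_trace_mul_le hW hcs
    have h2 := re_trace_mul_le hW hRB
    simp only [Matrix.mul_add, Matrix.mul_smul, Matrix.trace_add, Matrix.trace_smul, smul_eq_mul,
      Complex.add_re, Complex.re_ofReal_mul] at h1
    have h3 : 1 ≤ 1 / t := (one_le_div ht0).2 ht1
    have h4 : (W * (R * Q * R)).trace.re ≤ η := h2.trans hWB
    have h5 : (1 / t - 1) * (W * (R * Q * R)).trace.re ≤ (1 / t - 1) * η :=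
      mul_le_mul_of_nonneg_left h4 (by linarith)
    have h6 : (1 - t) * (1 - ε) ≤ (1 - t) * (W * Q).trace.re :=
      mul_le_mul_of_nonneg_left hWQ (by linarith)
    have h7 : η / t = 1 / t * η := by ring
    rw [h7]
    nlinarith [mul_nonneg ht0.le hε]

end Gentle

/-! ### Operators that detect a product state have large trace -/

section Shadow

theorem sum_compl_condTypicalSeq_le {I J Y : Type*} [Fintype I] [Fintype J] [DecidableEq Y]
    [DecidableEq I] [DecidableEq J] [Fintype Y] {R : Y → J → ℝ} (h0 : ∀ y j, 0 ≤ R y j)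
    (h1 : ∀ y, ∑ j, R y j = 1) (c : I → Y) {δ : ℝ} (hδ : 0 < δ) :
    ∑ v ∈ (condTypicalSeq c R δ)ᶜ, ∏ i, R (c i) (v i) ≤
      Fintype.card Y * Fintype.card J / δ ^ 2 := by
  have h := one_sub_le_sum_condTypicalSeq h0 h1 c hδ
  have h2 := Finset.sum_add_sum_compl (condTypicalSeq c R δ) fun v => ∏ i, R (c i) (v i)
  rw [sum_prod_weight_eq_one fun i => h1 (c i)] at h2
  linarith

variable {ι : Type*} [Fintype ι] [DecidableEq ι]

/-- If `0 ≤ B ≤ 1` has probability at least `η` in the state `ρ ^ ⊗n`, then its trace is at least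
of the order of `exp (n H(ρ))`, up to a factor exponential in `√n`. -/
theorem le_trace_of_le_trace_tensorOp_mul {ρ : DensityMatrix ι} (Δ : Diagonalization ρ) {n : ℕ}
    {B : Matrix (Fin n → ι) (Fin n → ι) ℂ} (hB : B.PosSemidef) (hB1 : (1 - B).PosSemidef)
    {η δ : ℝ} (hδ : 0 < δ) (hδη : Fintype.card ι / δ ^ 2 ≤ η / 2)
    (h : η ≤ (tensorOp (fun _ : Fin n => ρ.mat) * B).trace.re) :
    η / 2 * Real.exp (n * shannonNat Δ.weight - 2 * Fintype.card ι * δ * √n) ≤ B.trace.re := by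
  have hw0 : ∀ (_ : Unit) j, 0 ≤ Δ.weight j := fun _ => Δ.weight_nonneg
  have hw1 : ∀ _ : Unit, ∑ j, Δ.weight j = 1 := fun _ => Δ.sum_weight
  set T := condTypicalSeq (fun _ : Fin n => ()) (fun _ => Δ.weight) δ with hT
  set p : (Fin n → ι) → ℝ := fun v => ∏ i, Δ.weight (v i) with hp
  set b : (Fin n → ι) → ℝ := fun v => (seqProj (fun _ : Fin n => Δ) v * B).trace.re with hb
  have hp0 : ∀ v, 0 ≤ p v := fun v => Finset.prod_nonneg fun i _ => Δ.weight_nonneg _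
  have hb0 : ∀ v, 0 ≤ b v := fun v => re_trace_mul_nonneg (posSemidef_seqProj _ v) hB
  have hb1 : ∀ v, b v ≤ 1 := by
    intro v
    have := re_trace_mul_le (posSemidef_seqProj (fun _ : Fin n => Δ) v) hB1
    rwa [Matrix.mul_one, trace_seqProj, Complex.one_re] at this
  have hcompl : ∑ v ∈ Tᶜ, p v ≤ η / 2 := by
    have := sum_compl_condTypicalSeq_le hw0 hw1 (fun _ : Fin n => ()) hδ
    simp only [Fintype.card_unit, Nat.cast_one, one_mul] at this
    exact this.trans hδη
  rw [re_trace_tensorOp_mul fun _ : Fin n => Δ, ← Finset.sum_add_sum_compl T] at h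
  have hcompl2 : ∑ v ∈ Tᶜ, p v * b v ≤ ∑ v ∈ Tᶜ, p v :=
    Finset.sum_le_sum fun v _ => mul_le_of_le_one_right (hp0 v) (hb1 v)
  have htyp : ∀ v ∈ T, p v ≤
      Real.exp (-(n * shannonNat Δ.weight - 2 * Fintype.card ι * δ * √n)) := by
    intro v hv
    refine (prod_le_exp_of_mem_condTypicalSeq hw0 hw1 hδ hv).trans_eq ?_
    congr 1
    simp [labelCount]
    ring
  have hmain : η / 2 ≤
      Real.exp (-(n * shannonNat Δ.weight - 2 * Fintype.card ι * δ * √n)) * B.trace.re := by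
    calc η / 2 ≤ ∑ v ∈ T, p v * b v := by
          have : η ≤ ∑ v ∈ T, p v * b v + ∑ v ∈ Tᶜ, p v * b v := h
          linarith
      _ ≤ ∑ v ∈ T, Real.exp (-(n * shannonNat Δ.weight - 2 * Fintype.card ι * δ * √n)) * b v :=
          Finset.sum_le_sum fun v hv => mul_le_mul_of_nonneg_right (htyp v hv) (hb0 v)
      _ = Real.exp (-(n * shannonNat Δ.weight - 2 * Fintype.card ι * δ * √n)) *
          ∑ v ∈ T, b v := by rw [Finset.mul_sum]
      _ ≤ _ := by
          rw [re_trace_eq_sum_seqProj (fun _ : Fin n => Δ) B]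
          exact mul_le_mul_of_nonneg_left (Finset.sum_le_sum_of_subset_of_nonneg
            (Finset.subset_univ _) fun v _ _ => hb0 v) (Real.exp_pos _).le
  rwa [Real.exp_neg, mul_comm, ← div_eq_mul_inv, le_div_iff₀ (Real.exp_pos _)] at hmain

end Shadow

/-! ### Codewords drawn from a set of typical sequences -/

section Average

variable {X ι : Type*} [Fintype ι]

theorem posSemidef_outputOp [DecidableEq ι] (W : CQChannel X ι) {n : ℕ} (x : Fin n → X) :
    (outputOp W x).PosSemidef :=
  posSemidef_tensorOp_mat fun i => Diagonalization.ofEigenvectorBasis (W (x i))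

variable [Fintype X]

/-- The `n`-fold average state is the `P ^ n`-average of the output states. -/
theorem tensorOp_avgState (P : stdSimplex ℝ X) (W : CQChannel X ι) (n : ℕ) :
    tensorOp (fun _ : Fin n => (avgState P W).mat) =
      ∑ x : Fin n → X, ((∏ i, P.1 (x i) : ℝ) : ℂ) • outputOp W x := by
  rw [show (fun _ : Fin n => (avgState P W).mat) =
    fun _ => ∑ x, ((P.1 x : ℝ) : ℂ) • (W x).mat from rfl, tensorOp_sum]
  simp_rw [tensorOp_smul, outputOp]
  push_cast
  rfl

theorem re_trace_tensorOp_avgState_mul (P : stdSimplex ℝ X) (W : CQChannel X ι) {n : ℕ}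
    (B : Matrix (Fin n → ι) (Fin n → ι) ℂ) :
    (tensorOp (fun _ : Fin n => (avgState P W).mat) * B).trace.re =
      ∑ x : Fin n → X, (∏ i, P.1 (x i)) * (outputOp W x * B).trace.re := by
  rw [tensorOp_avgState]
  simp only [Finset.sum_mul, Matrix.smul_mul, Matrix.trace_sum, Matrix.trace_smul, Complex.re_sum,
    smul_eq_mul, Complex.re_ofReal_mul]

/-- If all outputs of inputs in `A` are detected by `B`, then so is the average state. -/
theorem mul_prodProb_le_re_trace [DecidableEq ι] (P : stdSimplex ℝ X) (W : CQChannel X ι) {n : ℕ}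
    {B : Matrix (Fin n → ι) (Fin n → ι) ℂ} (hB : B.PosSemidef) {A : Finset (Fin n → X)} {η : ℝ}
    (h : ∀ x ∈ A, η ≤ (outputOp W x * B).trace.re) :
    η * prodProb P A ≤ (tensorOp (fun _ : Fin n => (avgState P W).mat) * B).trace.re := by
  have hP : ∀ x : Fin n → X, 0 ≤ ∏ i, P.1 (x i) := fun x => Finset.prod_nonneg fun i _ => P.2.1 _
  rw [re_trace_tensorOp_avgState_mul, prodProb, Finset.mul_sum]
  calc _ ≤ ∑ x ∈ A, (∏ i, P.1 (x i)) * (outputOp W x * B).trace.re :=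
        Finset.sum_le_sum fun x hx => by
          rw [mul_comm]
          exact mul_le_mul_of_nonneg_left (h x hx) (hP x)
    _ ≤ _ := Finset.sum_le_sum_of_subset_of_nonneg (Finset.subset_univ _) fun x _ _ =>
        mul_nonneg (hP x) (re_trace_mul_nonneg (posSemidef_outputOp W x) hB)

variable [DecidableEq X]

theorem le_prodProb_inter_typical (P : stdSimplex ℝ X) {n : ℕ} (A : Finset (Fin n → X)) {δ : ℝ}
    (hδ : 0 < δ) :
    prodProb P A - Fintype.card X / δ ^ 2 ≤
      prodProb P (A ∩ condTypicalSeq (fun _ : Fin n => ()) (fun _ => P.1) δ) := by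
  set T := condTypicalSeq (fun _ : Fin n => ()) (fun _ => P.1) δ with hT
  have h := sum_compl_condTypicalSeq_le (fun _ => P.2.1) (fun _ => P.2.2)
    (fun _ : Fin n => ()) hδ
  simp only [Fintype.card_unit, Nat.cast_one, one_mul, ← hT] at h
  have h2 : ∑ x ∈ A \ T, ∏ i, P.1 (x i) ≤ ∑ x ∈ Tᶜ, ∏ i, P.1 (x i) :=
    Finset.sum_le_sum_of_subset_of_nonneg
      (fun x hx => Finset.mem_compl.2 (Finset.mem_sdiff.1 hx).2)
      fun x _ _ => Finset.prod_nonneg fun i _ => P.2.1 _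
  have h3 := Finset.sum_inter_add_sum_sdiff A T fun x => ∏ i, P.1 (x i)
  simp only [prodProb]
  linarith

/-- On a typical input sequence the entropies of the letters add up to at most `n` times their
`P`-average, up to an error of the order of `√n`. -/
theorem sum_labelCount_mul_le (P : stdSimplex ℝ X) {n : ℕ} {x : Fin n → X} {δ D : ℝ} (hδ : 0 < δ)
    (hx : x ∈ condTypicalSeq (fun _ : Fin n => ()) (fun _ => P.1) δ) {h : X → ℝ}
    (h0 : ∀ y, 0 ≤ h y) (hD : ∀ y, h y ≤ D) :
    ∑ y, (labelCount x y : ℝ) * h y ≤ n * ∑ y, P.1 y * h y + Fintype.card X * δ * D * √n := by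
  have hdev : ∀ y, (labelCount x y : ℝ) ≤ n * P.1 y + δ * √n := by
    intro y
    have h1 := mem_condTypicalSeq.1 hx () y
    have h2 : jointCount (fun _ : Fin n => ()) x () y = labelCount x y := by
      simp [jointCount, labelCount]
    have h3 : labelCount (fun _ : Fin n => ()) () = n := by simp [labelCount]
    rw [IsTypicalAt, h2, h3] at h1
    have hP0 := P.2.1 y
    have hP1 := le_one_of_sum_eq_one P.2.1 P.2.2 y
    have h4 : √(P.1 y * (1 - P.1 y)) ≤ 1 := Real.sqrt_le_one.2 (by nlinarith)
    have h5 : δ * √n * √(P.1 y * (1 - P.1 y)) ≤ δ * √n :=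
      mul_le_of_le_one_right (by positivity) h4
    linarith [(abs_le.1 h1).2]
  calc _ ≤ ∑ y, (n * (P.1 y * h y) + δ * √n * D) := by
        refine Finset.sum_le_sum fun y _ => ?_
        calc _ ≤ (n * P.1 y + δ * √n) * h y := mul_le_mul_of_nonneg_right (hdev y) (h0 y)
          _ ≤ n * (P.1 y * h y) + δ * √n * D := by
            have := mul_le_mul_of_nonneg_left (hD y) (by positivity : 0 ≤ δ * √n)
            linarith
    _ = _ := by
        rw [Finset.sum_add_distrib, ← Finset.mul_sum]
        simp
        ring

variable [DecidableEq ι]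

/-- The rank of the conditional typical projector of a typical input is governed by the
conditional entropy `H(W|P)`, here in nats. -/
theorem re_trace_condTypicalProj_le {W : CQChannel X ι} (Δ : ∀ y, Diagonalization (W y))
    (P : stdSimplex ℝ X) {n : ℕ} {x : Fin n → X} {δ δ' : ℝ} (hδ : 0 < δ) (hδ' : 0 < δ')
    (hx : x ∈ condTypicalSeq (fun _ : Fin n => ()) (fun _ => P.1) δ') :
    (condTypicalProj Δ δ x).trace.re ≤ Real.exp (n * ∑ y, P.1 y * shannonNat (Δ y).weight +
      (Fintype.card X * δ' * Fintype.card ι + 2 * Fintype.card X * Fintype.card ι * δ) * √n) := by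
  rw [condTypicalProj_eq_spanProj, trace_spanProj, Complex.natCast_re]
  refine (card_condTypicalSeq_le (fun y => (Δ y).weight_nonneg) (fun y => (Δ y).sum_weight) x
    hδ).trans (Real.exp_le_exp.2 ?_)
  have := sum_labelCount_mul_le P hδ' hx
    (fun y => shannonNat_nonneg (Δ y).weight_nonneg (Δ y).sum_weight)
    fun y => shannonNat_le_card (Δ y).weight_nonneg
  rw [Fintype.card_fin]
  linarith

theorem le_re_trace_outputOp_mul_condTypicalProj {W : CQChannel X ι}
    (Δ : ∀ y, Diagonalization (W y)) {n : ℕ} (x : Fin n → X) {δ : ℝ} (hδ : 0 < δ) :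
    1 - Fintype.card X * Fintype.card ι / δ ^ 2 ≤
      (outputOp W x * condTypicalProj Δ δ x).trace.re := by
  rw [condTypicalProj_eq_spanProj, outputOp, re_trace_tensorOp_mul_spanProj fun i => Δ (x i)]
  exact one_sub_le_sum_condTypicalSeq (fun y => (Δ y).weight_nonneg) (fun y => (Δ y).sum_weight)
    x hδ

end Average

/-! ### Greedy construction of the code -/

section Greedy

variable {X ι : Type*} [Fintype X] [DecidableEq X] [Fintype ι] [DecidableEq ι]

/-- A code with `k` messages whose decoding operators sum to at most the identity, with codewords
in `A`, error probability at most `lam`, and decoding operators no larger in trace than the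
conditional typical projectors of the codewords. -/
structure PartialCode {W : CQChannel X ι} (Δ : ∀ y, Diagonalization (W y)) (lam δ : ℝ) {n : ℕ}
    (A : Finset (Fin n → X)) (k : ℕ) where
  word : Fin k → Fin n → X
  op : Fin k → Matrix (Fin n → ι) (Fin n → ι) ℂ
  op_posSemidef : ∀ m, (op m).PosSemidef
  sum_op_le : (1 - ∑ m, op m).PosSemidef
  word_mem : ∀ m, word m ∈ A
  le_success : ∀ m, 1 - lam ≤ (outputOp W (word m) * op m).trace.re
  trace_op_le : ∀ m, (op m).trace.re ≤ (condTypicalProj Δ δ (word m)).trace.re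

namespace PartialCode

variable {W : CQChannel X ι} {Δ : ∀ y, Diagonalization (W y)} {lam δ : ℝ} {n : ℕ}
  {A : Finset (Fin n → X)} {k : ℕ}

/-- A code is extended by any codeword of `A` whose output is hardly detected by the operators used
so far: its decoding operator is the compression of its conditional typical projector. -/
theorem exists_succ (C : PartialCode Δ lam δ A k) (hlam0 : 0 < lam) (hlam1 : lam < 1) (hδ : 0 < δ)
    (hδl : Fintype.card X * Fintype.card ι / δ ^ 2 ≤ lam / 2) {x : Fin n → X} (hx : x ∈ A)
    (hxB : (outputOp W x * ∑ m, C.op m).trace.re ≤ lam ^ 2 / 16) :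
    Nonempty (PartialCode Δ lam δ A (k + 1)) := by
  have hQ := le_re_trace_outputOp_mul_condTypicalProj Δ x hδ
  -- The loss `t + ε + η / t` of the compression is `lam` for `ε = lam / 2`, `η = (lam / 4) ^ 2`
  -- and the optimal `t = √η`.
  obtain ⟨D, hD, hDB, hDtr, hDW⟩ := exists_compressed_projector (posSemidef_outputOp W x)
    (Matrix.posSemidef_sum _ fun m _ => C.op_posSemidef m) C.sum_op_le
    (Q := condTypicalProj Δ δ x) (by
      rw [condTypicalProj_eq_spanProj]
      exact isHermitian_spanProj _ _)
    (by rw [condTypicalProj_eq_spanProj, spanProj_mul_self])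
    (ε := lam / 2) (t := lam / 4) (by linarith) hxB (by linarith) (by linarith) (by positivity)
    (by linarith)
  have hloss : 1 - lam / 4 - lam / 2 - lam ^ 2 / 16 / (lam / 4) = 1 - lam := by
    field_simp
    ring
  rw [hloss] at hDW
  exact ⟨{
    word := Fin.cons x C.word
    op := Fin.cons D C.op
    op_posSemidef := by simpa [Fin.forall_fin_succ] using ⟨hD, C.op_posSemidef⟩
    sum_op_le := by simpa [Fin.sum_univ_succ] using hDB
    word_mem := by simpa [Fin.forall_fin_succ] using ⟨hx, C.word_mem⟩
    le_success := by
      rw [Fin.forall_fin_succ]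
      exact ⟨hDW, C.le_success⟩
    trace_op_le := by
      rw [Fin.forall_fin_succ]
      exact ⟨hDtr, C.trace_op_le⟩ }⟩

/-- If every typical sequence of a set `A` of positive probability is detected by the operators of
a code, then the code has about `exp (n I)` messages at least. -/
theorem le_card_of_forall_detected {δ' δ'' τ η : ℝ} {P : stdSimplex ℝ X}
    (C : PartialCode Δ lam δ (A ∩ condTypicalSeq (fun _ : Fin n => ()) (fun _ => P.1) δ') k)
    (hδ : 0 < δ) (hδ' : 0 < δ') (hδ'' : 0 < δ'') (hη : 0 < η)
    (hτ : τ ≤ prodProb P (A ∩ condTypicalSeq (fun _ : Fin n => ()) (fun _ => P.1) δ'))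
    (hδη : Fintype.card ι / δ'' ^ 2 ≤ η * τ / 2)
    (Γ : Diagonalization (avgState P W))
    (h : ∀ x ∈ A ∩ condTypicalSeq (fun _ : Fin n => ()) (fun _ => P.1) δ',
      η ≤ (outputOp W x * ∑ m, C.op m).trace.re) :
    η * τ / 2 * Real.exp (n * (shannonNat Γ.weight - ∑ y, P.1 y * shannonNat (Δ y).weight) -
      (2 * Fintype.card ι * δ'' + (Fintype.card X * δ' * Fintype.card ι +
        2 * Fintype.card X * Fintype.card ι * δ)) * √n) ≤ k := by
  have hB : (∑ m, C.op m).PosSemidef := Matrix.posSemidef_sum _ fun m _ => C.op_posSemidef m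
  have h1 := (mul_le_mul_of_nonneg_left hτ hη.le).trans (mul_prodProb_le_re_trace P W hB h)
  have h2 := le_trace_of_le_trace_tensorOp_mul Γ hB C.sum_op_le hδ'' hδη h1
  set E := n * ∑ y, P.1 y * shannonNat (Δ y).weight +
      (Fintype.card X * δ' * Fintype.card ι + 2 * Fintype.card X * Fintype.card ι * δ) * √n with hE
  have h3 : (∑ m, C.op m).trace.re ≤ k * Real.exp E := by
    rw [Matrix.trace_sum, Complex.re_sum]
    refine (Finset.sum_le_card_nsmul _ _ (Real.exp E) fun m _ => ?_).trans_eq (by simp)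
    exact (C.trace_op_le m).trans
      (re_trace_condTypicalProj_le Δ P hδ hδ' (Finset.mem_inter.1 (C.word_mem m)).2)
  have h4 := h2.trans h3
  rw [← div_le_iff₀ (Real.exp_pos _), mul_div_assoc, ← Real.exp_sub] at h4
  refine le_of_eq_of_le ?_ h4
  congr 2
  rw [hE]
  ring

/-- Completing the operators of a partial code by their complement gives a block code; the
complement is the outcome `none`. -/
def toBlockCode (C : PartialCode Δ lam δ A k) : BlockCode X ι n where
  Outcome := Option (Fin k)
  msgs := Finset.univ.map Function.Embedding.some
  encode m := C.word (m.1.get (by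
    obtain ⟨j, -, hj⟩ := Finset.mem_map.1 m.2
    rw [← hj]
    rfl))
  dec o := o.elim (1 - ∑ m, C.op m) C.op
  dec_posSemidef
    | none => C.sum_op_le
    | some m => C.op_posSemidef m
  dec_sum := by simp [Fintype.sum_option]

theorem card_msgs_toBlockCode (C : PartialCode Δ lam δ A k) : C.toBlockCode.msgs.card = k := by
  simp [toBlockCode]

theorem exists_eq_toBlockCode (C : PartialCode Δ lam δ A k) (m : C.toBlockCode.msgs) :
    ∃ j, C.toBlockCode.encode m = C.word j ∧ C.toBlockCode.dec m = C.op j := by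
  obtain ⟨m, hm⟩ := m
  obtain ⟨j, -, rfl⟩ := Finset.mem_map.1 hm
  exact ⟨j, rfl, rfl⟩

theorem isCode_toBlockCode (C : PartialCode Δ lam δ A k) (hlam : 0 ≤ lam) :
    C.toBlockCode.IsCode W lam := by
  refine Real.iSup_le (fun m => ?_) hlam
  obtain ⟨j, h1, h2⟩ := C.exists_eq_toBlockCode m
  rw [h1, h2]
  linarith [C.le_success j]

end PartialCode

end Greedy

end

theorem mainTheorem2 (lam τ : ℝ) (hlam : lam ∈ Set.Ioo (0 : ℝ) 1) (hτ : τ ∈ Set.Ioo (0 : ℝ) 1)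
    (a d : ℕ) :
    ∃ δ : ℝ, 0 < δ ∧ ∃ K : ℝ,
      ∀ (X : Type*) [Fintype X] [DecidableEq X] (ι : Type*) [Fintype ι] [DecidableEq ι],
        Fintype.card X = a → Fintype.card ι = d →
        ∀ (W : CQChannel X ι) (Δ : ∀ y, Diagonalization (W y)) (P : stdSimplex ℝ X)
          (n : ℕ), 0 < n →
        ∀ A : Finset (Fin n → X), τ ≤ prodProb P A →
          ∃ C : BlockCode X ι n, C.IsCode W lam ∧
            (∀ m : C.msgs, C.encode m ∈ A ∧
              (C.dec m).trace.re ≤ (condTypicalProj Δ δ (C.encode m)).trace.re) ∧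
            (2 : ℝ) ^ (n * mutualInfo P W - K * √n) ≤ (C.msgs.card : ℝ) := by
  obtain ⟨hlam0, hlam1⟩ := hlam
  have hτ0 := hτ.1
  -- The `+ 1` keeps the Chebyshev constants positive when the alphabet or the space is empty.
  have hcheb : ∀ c ε : ℝ, 0 ≤ c → 0 < ε →
      0 < √((c + 1) / ε) ∧ c / √((c + 1) / ε) ^ 2 ≤ ε := by
    intro c ε hc hε
    refine ⟨Real.sqrt_pos.2 (by positivity), ?_⟩
    rw [Real.sq_sqrt (by positivity), div_le_iff₀ (by positivity), mul_div_cancel₀ _ hε.ne']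
    linarith
  set η := lam ^ 2 / 16 with hηdef
  have hη : 0 < η := by positivity
  obtain ⟨hδ, hδl⟩ := hcheb (a * d) (lam / 2) (by positivity) (by positivity)
  obtain ⟨hδ', hδτ⟩ := hcheb a (τ / 2) (by positivity) (by positivity)
  obtain ⟨hδ'', hδη⟩ := hcheb d (η * (τ / 2) / 2) (by positivity) (by positivity)
  set δ := √((a * d + 1) / (lam / 2))
  set δ' := √((a + 1) / (τ / 2))
  set δ'' := √((d + 1) / (η * (τ / 2) / 2))
  set c := η * (τ / 2) / 2 with hc
  have hc0 : 0 < c := by positivity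
  set L := 2 * d * δ'' + (a * δ' * d + 2 * a * d * δ) with hL
  refine ⟨δ, hδ, (L + |Real.log c|) / Real.log 2, ?_⟩
  intro X _ _ ι _ _ hX hι W Δ P n hn A hA
  subst hX hι
  set T := condTypicalSeq (fun _ : Fin n => ()) (fun _ => P.1) δ' with hT
  set Γ := Diagonalization.ofEigenvectorBasis (avgState P W)
  have hAT : τ / 2 ≤ prodProb P (A ∩ T) := by
    have := le_prodProb_inter_typical P A hδ'
    linarith
  have hlog2 : 0 < Real.log 2 := Real.log_pos one_lt_two
  set M := (2 : ℝ) ^ (n * mutualInfo P W - (L + |Real.log c|) / Real.log 2 * √n) with hM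
  have hMle : M ≤ c * Real.exp (n * (shannonNat Γ.weight -
      ∑ y, P.1 y * shannonNat (Δ y).weight) - L * √n) := by
    have hcond : condEntropy P W = (∑ y, P.1 y * shannonNat (Δ y).weight) / Real.log 2 := by
      rw [condEntropy, Finset.sum_div]
      exact Finset.sum_congr rfl fun y _ => by rw [(Δ y).vnEntropy_eq, mul_div_assoc]
    rw [hM, mutualInfo, Γ.vnEntropy_eq, hcond, Real.rpow_def_of_pos two_pos]
    conv_rhs => rw [← Real.exp_log hc0, ← Real.exp_add]
    refine Real.exp_le_exp.2 ?_
    have hsqrt : 1 ≤ √(n : ℝ) := Real.one_le_sqrt.2 (by exact_mod_cast hn)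
    have h1 : |Real.log c| ≤ |Real.log c| * √n := le_mul_of_one_le_right (abs_nonneg _) hsqrt
    have h2 := neg_abs_le (Real.log c)
    field_simp
    linarith
  -- Codes grow by one codeword as long as they have fewer than `M` messages.
  have hgrow : ∀ k : ℕ, k ≤ ⌈M⌉₊ → Nonempty (PartialCode Δ lam δ (A ∩ T) k) := by
    intro k
    induction k with
    | zero =>
      exact fun _ => ⟨{
        word := Fin.elim0
        op := Fin.elim0
        op_posSemidef := fun m => m.elim0
        sum_op_le := by simpa using Matrix.PosSemidef.one
        word_mem := fun m => m.elim0
        le_success := fun m => m.elim0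
        trace_op_le := fun m => m.elim0 }⟩
    | succ k ih =>
      intro hk
      obtain ⟨C⟩ := ih (Nat.le_of_succ_le hk)
      by_contra hno
      have hdet : ∀ x ∈ A ∩ T, η ≤ (outputOp W x * ∑ m, C.op m).trace.re := by
        intro x hx
        by_contra! hlt
        exact hno (C.exists_succ hlam0 hlam1 hδ (by exact_mod_cast hδl) hx hlt.le)
      have hkM := C.le_card_of_forall_detected hδ hδ' hδ'' hη hAT hδη Γ hdet
      exact (Nat.lt_ceil.1 hk).not_ge (hMle.trans hkM)
  obtain ⟨C⟩ := hgrow _ le_rfl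
  refine ⟨C.toBlockCode, C.isCode_toBlockCode hlam0.le, fun m => ?_, ?_⟩
  · obtain ⟨j, h1, h2⟩ := C.exists_eq_toBlockCode m
    rw [h1, h2]
    exact ⟨(Finset.mem_inter.1 (C.word_mem j)).1, C.trace_op_le j⟩
  · rw [C.card_msgs_toBlockCode]
    exact Nat.le_ceil M
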